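/- Let $R$ be a one-dimensional Noetherian Cohen--Macaulay local ring with maximal ideal $\mathfrak m$ and total ring of fractions $Q$. Assume that $R$ is generically Gorenstein (that is, $R_{\mathfrak p}$ is Gorenstein for every minimal prime $\mathfrak p$ of $R$) and not Gorenstein, and let $\omega_R$ be a canonical ideal of $R$, that is, an ideal of $R$ which is isomorphic, as an $R$-module, to a canonical module of $R$. Let $x\in\omega_R$ be such that $(x)$ is a minimal reduction of $\omega_R$, let $K=x^{-1}\omega_R\subseteq Q$ be the corresponding fractional canonical ideal, and let $R[K]\subseteq Q$ be the $R$-subalgebra generated by $K$. Then the $R$-module $R[K]$ has minimal multiplicity with respect to $\omega_R$. That is, $\omega_R$ is $\mathfrak m$-primary, $R[K]$ is a nonzero finitely generated torsion-free $R$-module, and $$\mathrm{e}_R(\omega_R,R[K])=\mathrm{length}_R\bigl(\omega_R R[K]/\omega_R^2R[K]\bigr),$$ where $\mathrm{e}_R(\omega_R,M)=\lim_{n\to\infty}\mathrm{length}_R(M/\omega_R^nM)/n$ denotes the Hilbert--Samuel multiplicity of a finitely generated $R$-module $M$ with respect to $\omega_R$. -/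

import Mathlib

open CategoryTheory Filter

universe u v

/-- A maximal Cohen-Macaulay module over a Noetherian local ring `R`: a finitely generated module
having a regular sequence in the maximal ideal whose length is the Krull dimension of `R`
(that is, a finitely generated module of depth `dim R`). -/
def IsMaximalCohenMacaulay (R : Type u) [CommRing R] [IsLocalRing R]
    (M : Type v) [AddCommGroup M] [Module R M] : Prop :=
  Module.Finite R M ∧ ∃ rs : List R, (∀ r ∈ rs, r ∈ IsLocalRing.maximalIdeal R) ∧
    RingTheory.Sequence.IsRegular M rs ∧ ringKrullDim R = (rs.length : WithBot ℕ∞)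

/-- A Cohen-Macaulay (Noetherian) local ring: the depth equals the Krull dimension. -/
def IsCohenMacaulayLocalRing (R : Type u) [CommRing R] [IsLocalRing R] : Prop :=
  IsNoetherianRing R ∧ IsMaximalCohenMacaulay R R

/-- Finite injective dimension of a module. -/
def HasFiniteInjectiveDimension (R : Type u) [CommRing R]
    (M : Type u) [AddCommGroup M] [Module R M] : Prop :=
  ∃ n : ℕ, HasInjectiveDimensionLE (ModuleCat.of R M) n

/-- A Gorenstein local ring: a Noetherian local ring of finite injective dimension over itself. -/
def IsGorensteinLocalRing (R : Type u) [CommRing R] : Prop :=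
  IsLocalRing R ∧ IsNoetherianRing R ∧ HasFiniteInjectiveDimension R R

/-- A ring is generically Gorenstein if its localization at every minimal prime is Gorenstein. -/
def IsGenericallyGorenstein (R : Type u) [CommRing R] : Prop :=
  ∀ (p : Ideal R) [p.IsPrime], p ∈ minimalPrimes R →
    IsGorensteinLocalRing (Localization.AtPrime p)

/-- A maximal Cohen-Macaulay module has type one if `Ext^d(k, M)` is one-dimensional over the
residue field `k`, where `d` is the Krull dimension of the ring, which is the depth of `M`.
As `Ext^d(k, M)` is killed by the maximal ideal, its dimension over `k` is its length. -/
def HasTypeOne (R : Type u) [CommRing R] [IsLocalRing R]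
    (M : Type u) [AddCommGroup M] [Module R M] : Prop :=
  ∃ d : ℕ, ringKrullDim R = (d : WithBot ℕ∞) ∧
    Module.length R (Abelian.Ext
      (ModuleCat.of R (IsLocalRing.ResidueField R)) (ModuleCat.of R M) d) = 1

/-- A canonical module of a Cohen-Macaulay local ring: a maximal Cohen-Macaulay module of type one
and of finite injective dimension. -/
def IsCanonicalModule (R : Type u) [CommRing R] [IsLocalRing R]
    (M : Type u) [AddCommGroup M] [Module R M] : Prop :=
  IsMaximalCohenMacaulay R M ∧ HasTypeOne R M ∧ HasFiniteInjectiveDimension R M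

/-- A canonical ideal: an ideal which, as a module, is a canonical module. -/
def IsCanonicalIdeal {R : Type u} [CommRing R] [IsLocalRing R] (ω : Ideal R) : Prop :=
  IsCanonicalModule R ω

/-- `J` is a reduction of the ideal `I`. -/
def IsReduction {R : Type u} [CommRing R] (J I : Ideal R) : Prop :=
  J ≤ I ∧ ∃ n : ℕ, J * I ^ n = I ^ (n + 1)

/-- `J` is a minimal reduction of `I`: a reduction which contains no smaller reduction of `I`. -/
def IsMinimalReduction {R : Type u} [CommRing R] (J I : Ideal R) : Prop :=
  IsReduction J I ∧ ∀ J' : Ideal R, IsReduction J' I → J' ≤ J → J' = J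

/-- `e` is the Hilbert-Samuel multiplicity of `M` with respect to `I`:
`e = lim d! * length (M / I ^ n M) / n ^ d`, where `d` is the Krull dimension of the ring. -/
def HasMultiplicity {R : Type u} [CommRing R] (I : Ideal R)
    (M : Type v) [AddCommGroup M] [Module R M] (e : ℝ) : Prop :=
  ∃ d : ℕ, ringKrullDim R = (d : WithBot ℕ∞) ∧
    Tendsto (fun n : ℕ => (d.factorial : ℝ) *
      ((Module.length R (M ⧸ (I ^ n • (⊤ : Submodule R M)))).toNat : ℝ) / (n : ℝ) ^ d)
      atTop (nhds e)

/-- The length of `I M / I ^ 2 M`. -/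
noncomputable def lengthSMulQuotient {R : Type u} [CommRing R] (I : Ideal R)
    (M : Type v) [AddCommGroup M] [Module R M] : ℕ∞ :=
  Module.length R (↥(I • (⊤ : Submodule R M)) ⧸
    (I ^ 2 • (⊤ : Submodule R M)).submoduleOf (I • (⊤ : Submodule R M)))

/-- `M` has minimal multiplicity with respect to `I`: the ideal `I` is primary to the maximal
ideal, `M` is a nonzero finitely generated torsion-free module, and the multiplicity of `M` with
respect to `I` is equal to the (finite) length of `I M / I ^ 2 M`. -/
structure HasMinimalMultiplicity {R : Type u} [CommRing R] [IsLocalRing R] (I : Ideal R)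
    (M : Type v) [AddCommGroup M] [Module R M] : Prop where
  radical_eq : I.radical = IsLocalRing.maximalIdeal R
  finite : Module.Finite R M
  nontrivial : Nontrivial M
  torsionFree : Module.IsTorsionFree R M
  length_ne_top : lengthSMulQuotient I M ≠ ⊤
  multiplicity_eq : HasMultiplicity I M ((lengthSMulQuotient I M).toNat : ℝ)

/-- The submodule `x⁻¹ I` of the total ring of fractions `Q` of `R`, for an ideal `I` and a
non-zero-divisor `x` of `R`. -/
noncomputable def invMulIdeal {R : Type u} [CommRing R] (Q : Type v) [CommRing Q] [Algebra R Q]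
    (x : R) (I : Ideal R) : Submodule R Q :=
  (Submodule.map (Algebra.linearMap R Q) I).map
    (LinearMap.mulLeft R (Ring.inverse (algebraMap R Q x)))

/-! Everything rests on `x` being a nonzerodivisor. Then `ω = xK` inside `Q`, and since `K` lies in
`R[K]`, `ω R[K] = x R[K]`. Hence `ω ^ n R[K] = x ^ n R[K]`, whose colength is exactly `n` times that
of `x R[K]`, and multiplication by `x` identifies `R[K] / x R[K]` with `ω R[K] / ω ^ 2 R[K]`.
Finiteness of `R[K]` comes from the reduction equation: the powers of `K` stabilise.

As `(x)` is a reduction, it is enough that `ω` contains some nonzerodivisor; over a Noetherian ring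
this follows once `ω` is faithful (`IsCanonicalIdeal.eq_zero_of_mul_eq_zero`). A nonzero `a` with
`aω = 0` would force `Ext 1 (k, ω) = 0` for the residue field `k`, against type one; finite
injective dimension enters through the vanishing of `Ext 2` on modules of finite length. -/

section Ext

/-! ### Vanishing of Ext on modules of finite length -/

open CategoryTheory.Abelian

variable {R : Type u} [CommRing R]

/-- The short complex of modules attached to an exact pair of linear maps. -/
noncomputable abbrev shortComplexOfExact {M N P : Type u} [AddCommGroup M] [Module R M]
    [AddCommGroup N] [Module R N] [AddCommGroup P] [Module R P]
    (f : M →ₗ[R] N) (g : N →ₗ[R] P) (h : Function.Exact f g) : ShortComplex (ModuleCat.{u} R) :=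
  ModuleCat.shortComplexOfCompEqZero f g h.linearMap_comp_eq_zero

theorem shortExact_shortComplexOfExact {M N P : Type u} [AddCommGroup M] [Module R M]
    [AddCommGroup N] [Module R N] [AddCommGroup P] [Module R P]
    {f : M →ₗ[R] N} {g : N →ₗ[R] P} (h : Function.Exact f g)
    (hf : Function.Injective f) (hg : Function.Surjective g) :
    (shortComplexOfExact f g h).ShortExact :=
  ModuleCat.shortComplex_shortExact _ h hf hg

theorem subsingleton_ext_of_exact_middle {M N P Y : Type u} [AddCommGroup M] [Module R M]
    [AddCommGroup N] [Module R N] [AddCommGroup P] [Module R P] [AddCommGroup Y] [Module R Y]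
    {f : M →ₗ[R] N} {g : N →ₗ[R] P} (h : Function.Exact f g)
    (hf : Function.Injective f) (hg : Function.Surjective g) (n : ℕ)
    (hM : Subsingleton (Ext (ModuleCat.of R M) (ModuleCat.of R Y) n))
    (hP : Subsingleton (Ext (ModuleCat.of R P) (ModuleCat.of R Y) n)) :
    Subsingleton (Ext (ModuleCat.of R N) (ModuleCat.of R Y) n) := by
  refine subsingleton_of_forall_eq 0 fun e ↦ ?_
  obtain ⟨e', rfl⟩ := Ext.contravariant_sequence_exact₂
    (shortExact_shortComplexOfExact h hf hg) (ModuleCat.of R Y) e (hM.elim _ _)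
  rw [hP.elim e' 0, Ext.comp_zero]

theorem subsingleton_ext_of_exact_right {M N P Y : Type u} [AddCommGroup M] [Module R M]
    [AddCommGroup N] [Module R N] [AddCommGroup P] [Module R P] [AddCommGroup Y] [Module R Y]
    {f : M →ₗ[R] N} {g : N →ₗ[R] P} (h : Function.Exact f g)
    (hf : Function.Injective f) (hg : Function.Surjective g) (n : ℕ)
    (hM : Subsingleton (Ext (ModuleCat.of R M) (ModuleCat.of R Y) n))
    (hN : Subsingleton (Ext (ModuleCat.of R N) (ModuleCat.of R Y) (n + 1))) :
    Subsingleton (Ext (ModuleCat.of R P) (ModuleCat.of R Y) (n + 1)) := by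
  refine subsingleton_of_forall_eq 0 fun e ↦ ?_
  obtain ⟨e', rfl⟩ := Ext.contravariant_sequence_exact₃
    (shortExact_shortComplexOfExact h hf hg) (ModuleCat.of R Y) e (hN.elim _ _) (add_comm 1 n)
  rw [hM.elim e' 0, Ext.comp_zero]

theorem subsingleton_ext_of_exact_left {M N P Y : Type u} [AddCommGroup M] [Module R M]
    [AddCommGroup N] [Module R N] [AddCommGroup P] [Module R P] [AddCommGroup Y] [Module R Y]
    {f : M →ₗ[R] N} {g : N →ₗ[R] P} (h : Function.Exact f g)
    (hf : Function.Injective f) (hg : Function.Surjective g) (n : ℕ)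
    (hN : Subsingleton (Ext (ModuleCat.of R N) (ModuleCat.of R Y) n))
    (hP : Subsingleton (Ext (ModuleCat.of R P) (ModuleCat.of R Y) (n + 1))) :
    Subsingleton (Ext (ModuleCat.of R M) (ModuleCat.of R Y) n) := by
  refine subsingleton_of_forall_eq 0 fun e ↦ ?_
  obtain ⟨e', rfl⟩ := Ext.contravariant_sequence_exact₁
    (shortExact_shortComplexOfExact h hf hg) (ModuleCat.of R Y) e (add_comm 1 n) (hP.elim _ _)
  rw [hN.elim e' 0, Ext.comp_zero]

theorem subsingleton_ext_congr {M N Y : Type u} [AddCommGroup M] [Module R M]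
    [AddCommGroup N] [Module R N] [AddCommGroup Y] [Module R Y] (e : M ≃ₗ[R] N) (n : ℕ)
    (h : Subsingleton (Ext (ModuleCat.of R M) (ModuleCat.of R Y) n)) :
    Subsingleton (Ext (ModuleCat.of R N) (ModuleCat.of R Y) n) := by
  refine subsingleton_of_forall_eq 0 fun x ↦ ?_
  rw [← x.mk₀_id_comp, ← e.toModuleIso.inv_hom_id, ← Ext.mk₀_comp_mk₀_assoc,
    h.elim ((Ext.mk₀ e.toModuleIso.hom).comp x (zero_add n)) 0, Ext.comp_zero]

theorem IsFiniteLength.subsingleton_ext {N Y : Type u} [AddCommGroup N] [Module R N]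
    [AddCommGroup Y] [Module R Y] (n : ℕ)
    (hS : ∀ (S : Type u) [AddCommGroup S] [Module R S] [IsSimpleModule R S],
      Subsingleton (Ext (ModuleCat.of R S) (ModuleCat.of R Y) n))
    (hN : IsFiniteLength R N) : Subsingleton (Ext (ModuleCat.of R N) (ModuleCat.of R Y) n) := by
  induction hN with
  | @of_subsingleton M _ _ _ =>
    refine subsingleton_of_forall_eq 0 fun x ↦ ?_
    have h0 : 𝟙 (ModuleCat.of R M) = 0 := by ext m; exact Subsingleton.elim (α := M) _ _
    rw [← x.mk₀_id_comp, h0, Ext.mk₀_zero, Ext.zero_comp]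
  | @of_simple_quotient M _ _ N _ _ ih =>
    exact subsingleton_ext_of_exact_middle (LinearMap.exact_subtype_mkQ N) N.injective_subtype
      N.mkQ_surjective n ih (hS _)

theorem subsingleton_ext_self_succ {Y : Type u} [AddCommGroup Y] [Module R Y] (n : ℕ) :
    Subsingleton (Ext (ModuleCat.of R R) (ModuleCat.of R Y) (n + 1)) := by
  have : Projective (ModuleCat.of R R) := ModuleCat.projective_of_free (Module.Basis.singleton Unit R)
  exact Ext.subsingleton_of_projective _ _ n

theorem subsingleton_ext_quotient_span_singleton {Y : Type u} [AddCommGroup Y] [Module R Y]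
    {y : R} (hy : y ∈ nonZeroDivisors R) (n : ℕ) :
    Subsingleton (Ext (ModuleCat.of R (R ⧸ Ideal.span {y})) (ModuleCat.of R Y) (n + 2)) := by
  have hex : Function.Exact (LinearMap.mulLeft R y) (Ideal.span {y}).mkQ := by
    rw [LinearMap.exact_iff, Submodule.ker_mkQ]
    ext r
    simp [Ideal.mem_span_singleton', mul_comm]
  refine subsingleton_ext_of_exact_right hex ?_ (Submodule.mkQ_surjective _) (n + 1)
    (subsingleton_ext_self_succ n) (subsingleton_ext_self_succ (n + 1))
  intro a b hab
  exact (mul_cancel_left_mem_nonZeroDivisors hy).mp hab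

theorem IsSimpleModule.nonempty_linearEquiv_of_isLocalRing [IsLocalRing R] (S T : Type*)
    [AddCommGroup S] [Module R S] [IsSimpleModule R S] [AddCommGroup T] [Module R T]
    [IsSimpleModule R T] : Nonempty (S ≃ₗ[R] T) := by
  obtain ⟨I, hI, ⟨e⟩⟩ := isSimpleModule_iff_quot_maximal.mp ‹IsSimpleModule R S›
  obtain ⟨J, hJ, ⟨f⟩⟩ := isSimpleModule_iff_quot_maximal.mp ‹IsSimpleModule R T›
  obtain rfl : I = J := (IsLocalRing.eq_maximalIdeal hI).trans (IsLocalRing.eq_maximalIdeal hJ).symm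
  exact ⟨e.trans f.symm⟩

theorem IsFiniteLength.exists_isSimpleModule_le {M : Type*} [AddCommGroup M] [Module R M]
    (hM : IsFiniteLength R M) {P : Submodule R M} (hP : P ≠ ⊥) :
    ∃ S ≤ P, IsSimpleModule R S := by
  obtain ⟨_, _⟩ := isFiniteLength_iff_isNoetherian_isArtinian.mp hM
  obtain ⟨S, hS, hSP⟩ := (eq_bot_or_exists_atom_le P).resolve_left hP
  exact ⟨S, hSP, isSimpleModule_iff_isAtom.mpr hS⟩

/-- Over a local ring with a nonunit nonzerodivisor `y` such that `R / y` has finite length, the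
groups `Ext i (N, Y)` vanish for `i ≥ 2` if `N` has finite length and `Y` has finite injective
dimension. -/
theorem HasFiniteInjectiveDimension.subsingleton_ext [IsLocalRing R] {Y : Type u} [AddCommGroup Y]
    [Module R Y] (hY : HasFiniteInjectiveDimension R Y) {y : R} (hy : y ∈ nonZeroDivisors R)
    (hym : y ∈ IsLocalRing.maximalIdeal R) (hfin : IsFiniteLength R (R ⧸ Ideal.span {y}))
    (n : ℕ) {N : Type u} [AddCommGroup N] [Module R N] (hN : IsFiniteLength R N) :
    Subsingleton (Ext (ModuleCat.of R N) (ModuleCat.of R Y) (n + 2)) := by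
  obtain ⟨d, hd⟩ := hY
  -- Descending induction on the degree; `k` bounds the distance to the range above `d`, where all
  -- Ext vanish. A simple module embeds in `R / y`, so its Ext in degree `n + 2` is squeezed between
  -- that of `R / y`, which is zero, and that of the cokernel in degree `n + 3`.
  suffices ∀ k n : ℕ, d < n + 2 + k → ∀ (S : Type u) [AddCommGroup S] [Module R S]
      [IsSimpleModule R S], Subsingleton (Ext (ModuleCat.of R S) (ModuleCat.of R Y) (n + 2)) from
    hN.subsingleton_ext _ (this (d + 1) n (by lia))
  intro k
  induction k with
  | zero =>
    intro n hn S _ _ _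
    exact HasInjectiveDimensionLT.subsingleton _ (d + 1) _ (by lia) _
  | succ k ih =>
    intro n hn S _ _ _
    have : Nontrivial (R ⧸ Ideal.span {y}) := Ideal.Quotient.nontrivial_iff.mpr fun h ↦
      (IsLocalRing.maximalIdeal.isMaximal R).ne_top
        (top_le_iff.mp (h ▸ (Ideal.span_singleton_le_iff_mem _).mpr hym))
    obtain ⟨T, -, hT⟩ := hfin.exists_isSimpleModule_le (P := ⊤) top_ne_bot
    obtain ⟨e⟩ := IsSimpleModule.nonempty_linearEquiv_of_isLocalRing (R := R) T S
    refine subsingleton_ext_congr e _ ?_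
    exact subsingleton_ext_of_exact_left (LinearMap.exact_subtype_mkQ T) T.injective_subtype
      T.mkQ_surjective (n + 2) (subsingleton_ext_quotient_span_singleton hy n)
      ((hfin.of_surjective T.mkQ_surjective).subsingleton_ext _ (ih (n + 1) (by lia)))

theorem CategoryTheory.Abelian.Ext.smul_eq_zero_of_smul_right {M Y : Type u} [AddCommGroup M] [Module R M]
    [AddCommGroup Y] [Module R Y] {s : R} (hs : ∀ y : Y, s • y = 0) {n : ℕ}
    (e : Ext (ModuleCat.of R M) (ModuleCat.of R Y) n) : s • e = 0 := by
  have h0 : s • 𝟙 (ModuleCat.of R Y) = 0 := by ext m; exact hs m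
  rw [Ext.smul_eq_comp_mk₀, h0, Ext.mk₀_zero, Ext.comp_zero]

/-- Let `z` be regular on `Y`, let `S` be a simple submodule of `R / z` meeting the multiples of an
element `a` which kills `Y`, and suppose that `Ext 2 ((R / z) / S, Y) = 0`. Then
`Ext 1 (S, Y) = 0`. -/
theorem subsingleton_ext_one_of_smul_eq_zero {Y : Type u} [AddCommGroup Y]
    [Module R Y] {a z : R} (ha : ∀ y : Y, a • y = 0) (hz : IsSMulRegular Y z)
    (S : Submodule R (R ⧸ Ideal.span {z})) [IsSimpleModule R S]
    (hS : S ≤ R ∙ (Ideal.Quotient.mk (Ideal.span {z}) a))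
    (hext : Subsingleton (Ext (ModuleCat.of R ((R ⧸ Ideal.span {z}) ⧸ S)) (ModuleCat.of R Y) 2)) :
    Subsingleton (Ext (ModuleCat.of R S) (ModuleCat.of R Y) 1) := by
  have := IsSimpleModule.nontrivial R S
  obtain ⟨t, ht⟩ := exists_ne (0 : S)
  obtain ⟨r, hr⟩ := Submodule.mem_span_singleton.mp (hS t.2)
  have hker : Ideal.span {z} ≤ LinearMap.ker (LinearMap.toSpanSingleton R S t) := by
    rw [Ideal.span_singleton_le_iff_mem, LinearMap.mem_ker, LinearMap.toSpanSingleton_apply]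
    ext
    rw [Submodule.coe_smul, ← hr, Algebra.smul_def, Algebra.smul_def, Ideal.Quotient.algebraMap_eq,
      Ideal.Quotient.eq_zero_iff_mem.mpr (Ideal.mem_span_singleton_self z)]
    simp
  let f : (R ⧸ Ideal.span {z}) →ₗ[R] S := (Ideal.span {z}).liftQ _ hker
  have hf : Function.Surjective f := fun s ↦ by
    obtain ⟨b, hb⟩ := IsSimpleModule.toSpanSingleton_surjective R ht s
    exact ⟨Ideal.Quotient.mk _ b, hb⟩
  -- Going through `S` is multiplication by `r * a`, which acts as zero on Ext into `Y`.
  have hcomp : ModuleCat.ofHom f ≫ ModuleCat.ofHom S.subtype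
      = (r * a) • 𝟙 (ModuleCat.of R (R ⧸ Ideal.span {z})) := by
    refine ModuleCat.hom_ext (LinearMap.ext fun b ↦ ?_)
    obtain ⟨b, rfl⟩ := Ideal.Quotient.mk_surjective b
    change ((b • t : S) : R ⧸ Ideal.span {z}) = (r * a) • (Ideal.Quotient.mk _ b)
    rw [Submodule.coe_smul, ← hr, Algebra.smul_def, Algebra.smul_def, Algebra.smul_def,
      Ideal.Quotient.algebraMap_eq, map_mul]
    ring
  -- `z` kills `ker f` but is regular on `Y`, so there are no nonzero maps; hence pullback along `f`
  -- is injective on `Ext 1`.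
  have hhom : Subsingleton (Ext (ModuleCat.of R (LinearMap.ker f)) (ModuleCat.of R Y) 0) := by
    refine subsingleton_of_forall_eq 0 fun e ↦ ?_
    obtain ⟨g, rfl⟩ := Ext.homEquiv₀.symm.surjective e
    have : g = 0 := by
      ext b
      have hb : z • b = 0 := by
        ext
        rw [Submodule.coe_smul, Algebra.smul_def, Ideal.Quotient.algebraMap_eq,
          Ideal.Quotient.eq_zero_iff_mem.mpr (Ideal.mem_span_singleton_self z)]
        simp
      refine hz ?_
      change z • g.hom b = z • (0 : Y)
      rw [← map_smul, hb, map_zero, smul_zero]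
    simp [this]
  refine subsingleton_of_forall_eq 0 fun e ↦ ?_
  -- As `Ext 2` of the cokernel vanishes, `e` extends to a class `e'` on `R / z`; its pullback along
  -- `f` is `(r * a) • e' = 0`.
  obtain ⟨e', he'⟩ := Ext.contravariant_sequence_exact₁
    (shortExact_shortComplexOfExact (LinearMap.exact_subtype_mkQ S) S.injective_subtype
      S.mkQ_surjective) (ModuleCat.of R Y) e (add_comm 1 1) (hext.elim _ _)
  obtain ⟨e'', he''⟩ := Ext.contravariant_sequence_exact₃
    (shortExact_shortComplexOfExact (LinearMap.exact_subtype_ker_map f)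
      (LinearMap.ker f).injective_subtype hf) (ModuleCat.of R Y) e (by
        rw [← he']
        change (Ext.mk₀ (ModuleCat.ofHom f)).comp
          ((Ext.mk₀ (ModuleCat.ofHom S.subtype)).comp e' _) _ = 0
        rw [Ext.mk₀_comp_mk₀_assoc, hcomp, Ext.mk₀_smul, Ext.smul_comp, Ext.mk₀_id_comp]
        exact Ext.smul_eq_zero_of_smul_right
          (fun y ↦ by rw [mul_smul, ha, smul_zero]) e') (add_comm 1 0)
  rw [← he'', hhom.elim e'' 0, Ext.comp_zero]

end Ext

/-! ### Nonzerodivisors in canonical ideals -/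

section CanonicalIdeal

variable {R : Type u} [CommRing R] [IsLocalRing R]

theorem IsMaximalCohenMacaulay.exists_mem_nonZeroDivisors (hR : IsMaximalCohenMacaulay R R)
    (hdim : ringKrullDim R = 1) :
    ∃ y ∈ nonZeroDivisors R, y ∈ IsLocalRing.maximalIdeal R := by
  obtain ⟨-, rs, hrs, hreg, hlen⟩ := hR
  match rs, hlen with
  | [], hlen => simp [hdim] at hlen
  | y :: rs, _ =>
    refine ⟨y, ?_, hrs y (by simp)⟩
    have := ((RingTheory.Sequence.isWeaklyRegular_cons_iff R y rs).mp hreg.toIsWeaklyRegular).1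
    exact mem_nonZeroDivisors_iff_right.mpr fun b hb ↦
      this (by simpa [mul_comm] using hb)

theorem Ideal.isSMulRegular_of_mem_nonZeroDivisors {R : Type*} [CommRing R] (I : Ideal R) {z : R}
    (hz : z ∈ nonZeroDivisors R) : IsSMulRegular I z := fun _ _ h ↦
  Subtype.ext ((mul_cancel_left_mem_nonZeroDivisors hz).mp (congrArg Subtype.val h))

theorem IsCanonicalIdeal.eq_zero_of_mul_eq_zero [IsNoetherianRing R] {ω : Ideal R}
    (hω : IsCanonicalIdeal ω) (hdim : ringKrullDim R = 1) {y : R} (hy : y ∈ nonZeroDivisors R)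
    (hym : y ∈ IsLocalRing.maximalIdeal R) {a : R} (ha : ∀ w ∈ ω, a * w = 0) : a = 0 := by
  obtain ⟨-, ⟨d, hd, hlen⟩, hinj⟩ := hω
  obtain rfl : d = 1 := by
    rw [hdim] at hd
    exact_mod_cast hd.symm
  have : Ring.KrullDimLE 1 R := Ring.krullDimLE_iff.mpr hdim.le
  by_contra h0
  -- Krull's intersection theorem: `a` survives in `R / y ^ n` for some `n`, so its multiples there
  -- contain a simple submodule.
  obtain ⟨n, hn⟩ : ∃ n : ℕ, a ∉ Ideal.span {y ^ n} := by
    by_contra! h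
    have hbot := Ideal.iInf_pow_eq_bot_of_isLocalRing (Ideal.span {y}) fun htop ↦
      (IsLocalRing.maximalIdeal.isMaximal R).ne_top
        (top_le_iff.mp (htop ▸ (Ideal.span_singleton_le_iff_mem _).mpr hym))
    refine h0 (hbot.le (Ideal.mem_iInf.mpr fun n ↦ ?_))
    rw [Ideal.span_singleton_pow]
    exact h n
  have hz : y ^ n ∈ nonZeroDivisors R := pow_mem hy n
  have hfin := isFiniteLength_quotient_span_singleton R hz
  obtain ⟨S, hS, hSs⟩ := hfin.exists_isSimpleModule_le
    (P := R ∙ (Ideal.Quotient.mk (Ideal.span {y ^ n}) a)) fun h ↦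
      hn (Ideal.Quotient.eq_zero_iff_mem.mp (Submodule.span_singleton_eq_bot.mp h))
  have hsub := subsingleton_ext_one_of_smul_eq_zero (Y := ω)
    (fun w ↦ Subtype.ext (ha w w.2)) (ω.isSMulRegular_of_mem_nonZeroDivisors hz) S hS
    (hinj.subsingleton_ext hy hym (isFiniteLength_quotient_span_singleton R hy) 0
      (hfin.of_surjective S.mkQ_surjective))
  have : IsSimpleModule R (IsLocalRing.ResidueField R) :=
    isSimpleModule_iff_quot_maximal.mpr
      ⟨_, IsLocalRing.maximalIdeal.isMaximal R, ⟨LinearEquiv.refl R _⟩⟩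
  obtain ⟨e⟩ := IsSimpleModule.nonempty_linearEquiv_of_isLocalRing (R := R) S
    (IsLocalRing.ResidueField R)
  have := subsingleton_ext_congr e 1 hsub
  rw [Module.length_eq_zero] at hlen
  exact zero_ne_one hlen

theorem IsCanonicalIdeal.exists_mem_nonZeroDivisors [IsNoetherianRing R] {ω : Ideal R}
    (hω : IsCanonicalIdeal ω) (hdim : ringKrullDim R = 1) {y : R} (hy : y ∈ nonZeroDivisors R)
    (hym : y ∈ IsLocalRing.maximalIdeal R) : ∃ w ∈ ω, w ∈ nonZeroDivisors R := by
  by_contra! h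
  obtain ⟨-, a, ha, ha0⟩ := SetLike.lt_iff_le_and_exists.mp
    (Ideal.bot_lt_annihilator_of_disjoint_nonZeroDivisors (Set.disjoint_left.mpr h))
  exact ha0 (hω.eq_zero_of_mul_eq_zero hdim hy hym fun w hw ↦
    Submodule.mem_annihilator.mp ha w hw)

theorem HasFiniteInjectiveDimension.congr {R : Type u} [CommRing R] {M N : Type u} [AddCommGroup M]
    [Module R M] [AddCommGroup N] [Module R N] (e : M ≃ₗ[R] N)
    (h : HasFiniteInjectiveDimension R M) : HasFiniteInjectiveDimension R N := by
  obtain ⟨n, hn⟩ := h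
  exact ⟨n, hasInjectiveDimensionLT_of_iso e.toModuleIso (n + 1)⟩

/-- Otherwise `R` would inherit finite injective dimension from `ω`. -/
theorem IsCanonicalIdeal.ne_top [IsNoetherianRing R] {ω : Ideal R} (hω : IsCanonicalIdeal ω)
    (hR : ¬ IsGorensteinLocalRing R) : ω ≠ ⊤ := fun h ↦
  hR ⟨inferInstance, inferInstance, hω.2.2.congr (LinearEquiv.ofTop ω h)⟩

/-- The reduction equation makes `x` a divisor of the nonzerodivisor `w ^ (n + 1)`. -/
theorem IsReduction.mem_nonZeroDivisors {R : Type*} [CommRing R] {I : Ideal R} {x w : R}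
    (hx : IsReduction (Ideal.span {x}) I) (hw : w ∈ I) (hw0 : w ∈ nonZeroDivisors R) :
    x ∈ nonZeroDivisors R := by
  obtain ⟨-, n, hn⟩ := hx
  have hmem : w ^ (n + 1) ∈ Ideal.span {x} * I ^ n := by
    rw [hn]
    exact Ideal.pow_mem_pow hw (n + 1)
  obtain ⟨c, -, hc⟩ := Ideal.mem_span_singleton_mul.mp hmem
  have hxc : x * c ∈ nonZeroDivisors R := by
    rw [hc]
    exact pow_mem hw0 (n + 1)
  exact (mul_mem_nonZeroDivisors.mp hxc).1

/-- `R / x` is Artinian, so every prime containing `x` is maximal. -/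
theorem Ideal.radical_eq_maximalIdeal_of_mem_nonZeroDivisors [Ring.KrullDimLE 1 R]
    [IsNoetherianRing R] {I : Ideal R}
    {x : R} (hI : I ≠ ⊤) (hxI : x ∈ I) (hx : x ∈ nonZeroDivisors R) :
    I.radical = IsLocalRing.maximalIdeal R := by
  refine le_antisymm ((IsLocalRing.maximalIdeal.isMaximal R).isPrime.radical_le_iff.mpr
    (IsLocalRing.le_maximalIdeal hI)) ?_
  rw [Ideal.radical_eq_sInf]
  refine le_sInf fun p ⟨hIp, hp⟩ ↦ ?_
  have hart : IsArtinianRing (R ⧸ Ideal.span {x}) := by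
    have := (isFiniteLength_iff_isNoetherian_isArtinian.mp
      (isFiniteLength_quotient_span_singleton R hx)).2
    exact isArtinian_of_tower R this
  have hxp : Ideal.span {x} ≤ p := (Ideal.span_singleton_le_iff_mem _).mpr (hIp hxI)
  have hp' : (p.map (Ideal.Quotient.mk (Ideal.span {x}))).IsPrime :=
    Ideal.map_isPrime_of_surjective Ideal.Quotient.mk_surjective (by rwa [Ideal.mk_ker])
  have hmax : (p.map (Ideal.Quotient.mk (Ideal.span {x}))).IsMaximal :=
    IsArtinianRing.isMaximal_of_isPrime _
  have := Ideal.comap_isMaximal_of_surjective (Ideal.Quotient.mk (Ideal.span {x}))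
    Ideal.Quotient.mk_surjective (K := p.map (Ideal.Quotient.mk (Ideal.span {x})))
  rw [Ideal.comap_map_of_surjective _ Ideal.Quotient.mk_surjective, ← RingHom.ker_eq_comap_bot,
    Ideal.mk_ker, sup_eq_left.mpr hxp] at this
  exact (IsLocalRing.eq_maximalIdeal this).ge

end CanonicalIdeal

/-! ### Multiplicity when `I M = x M` -/

section Multiplicity

variable {R : Type*} [CommRing R] {M : Type*} [AddCommGroup M] [Module R M]

open scoped Pointwise in
-- Additivity of length along `0 → M / bM → M / abM → M / aM → 0`, the first map being
-- multiplication by `a`.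
theorem Module.length_quotient_mul_span_singleton {a b : R} (ha : IsSMulRegular M a) :
    Module.length R (M ⧸ (Ideal.span {a * b} • ⊤ : Submodule R M)) =
      Module.length R (M ⧸ (Ideal.span {b} • ⊤ : Submodule R M)) +
        Module.length R (M ⧸ (Ideal.span {a} • ⊤ : Submodule R M)) := by
  rw [Submodule.ideal_span_singleton_smul, Submodule.ideal_span_singleton_smul,
    Submodule.ideal_span_singleton_smul]
  have hle : (a * b) • (⊤ : Submodule R M) ≤ a • ⊤ := by
    rw [mul_smul]
    exact smul_mono_right a le_top
  have hcomap : b • (⊤ : Submodule R M) =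
      ((a * b) • (⊤ : Submodule R M)).comap (LinearMap.lsmul R M a) := by
    ext m
    rw [Submodule.mem_comap, LinearMap.lsmul_apply, Submodule.mem_smul_pointwise_iff_exists,
      Submodule.mem_smul_pointwise_iff_exists]
    refine exists_congr fun s ↦ and_congr_right fun _ ↦ ?_
    rw [mul_smul]
    exact ha.eq_iff.symm
  refine Module.length_eq_add_of_exact
    (Submodule.mapQ (b • ⊤) ((a * b) • ⊤) (LinearMap.lsmul R M a) hcomap.le)
    (Submodule.factor hle) ?_ (Submodule.factor_surjective hle) ?_
  · rw [← LinearMap.ker_eq_bot, Submodule.ker_mapQ, ← hcomap, Submodule.mkQ_map_self]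
  · rw [LinearMap.exact_iff, Submodule.range_mapQ, Submodule.factor, Submodule.ker_mapQ,
      Submodule.comap_id]
    congr 1
    ext m
    simp [Submodule.mem_smul_pointwise_iff_exists]

theorem Module.length_quotient_pow_span_singleton {x : R} (hx : IsSMulRegular M x) (n : ℕ) :
    Module.length R (M ⧸ (Ideal.span {x ^ n} • ⊤ : Submodule R M)) =
      n * Module.length R (M ⧸ (Ideal.span {x} • ⊤ : Submodule R M)) := by
  induction n with
  | zero =>
    have : Subsingleton (M ⧸ (Ideal.span {x ^ 0} • ⊤ : Submodule R M)) := by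
      rw [Submodule.Quotient.subsingleton_iff]
      simp
    simp [Module.length_eq_zero]
  | succ n ih =>
    rw [pow_succ, mul_comm, Module.length_quotient_mul_span_singleton hx, ih]
    push_cast
    ring

theorem Ideal.pow_smul_top_eq_of_smul_top_eq {I : Ideal R} {x : R}
    (h : I • (⊤ : Submodule R M) = Ideal.span {x} • ⊤) (n : ℕ) :
    I ^ n • (⊤ : Submodule R M) = Ideal.span {x ^ n} • ⊤ := by
  induction n with
  | zero => simp
  | succ n ih =>
    rw [pow_succ, mul_comm, Submodule.mul_smul, ih, ← Submodule.mul_smul, mul_comm,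
      Submodule.mul_smul, h, ← Submodule.mul_smul, Ideal.span_singleton_mul_span_singleton,
      pow_succ]

open scoped Pointwise in
theorem lengthSMulQuotient_eq_of_smul_top_eq {I : Ideal R} {x : R} (hx : IsSMulRegular M x)
    (h : I • (⊤ : Submodule R M) = Ideal.span {x} • ⊤) :
    lengthSMulQuotient I M = Module.length R (M ⧸ (Ideal.span {x} • ⊤ : Submodule R M)) := by
  rw [lengthSMulQuotient, Ideal.pow_smul_top_eq_of_smul_top_eq h, h]
  rw [Submodule.ideal_span_singleton_smul, Submodule.ideal_span_singleton_smul]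
  let f : M →ₗ[R] (x • (⊤ : Submodule R M) : Submodule R M) :=
    (LinearMap.lsmul R M x).codRestrict _ fun m ↦
      Submodule.smul_mem_pointwise_smul m x ⊤ Submodule.mem_top
  have hf : Function.Bijective f := by
    refine ⟨fun a b hab ↦ hx (congrArg Subtype.val hab), fun ⟨m, hm⟩ ↦ ?_⟩
    obtain ⟨s, -, rfl⟩ := (Submodule.mem_smul_pointwise_iff_exists _ _ _).mp hm
    exact ⟨s, rfl⟩
  refine (Submodule.Quotient.equiv _ _ (LinearEquiv.ofBijective f hf) ?_).length_eq.symm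
  ext m
  rw [Submodule.mem_map, Submodule.submoduleOf, Submodule.mem_comap,
    Submodule.mem_smul_pointwise_iff_exists]
  constructor
  · rintro ⟨_, hs, rfl⟩
    obtain ⟨s, -, rfl⟩ := (Submodule.mem_smul_pointwise_iff_exists _ _ _).mp hs
    exact ⟨s, Submodule.mem_top, by rw [pow_two, mul_smul]; rfl⟩
  · rintro ⟨s, -, hs⟩
    refine ⟨x • s, Submodule.smul_mem_pointwise_smul s x ⊤ Submodule.mem_top, Subtype.ext ?_⟩
    rw [pow_two, mul_smul] at hs
    exact hs

theorem hasMultiplicity_of_smul_top_eq {I : Ideal R} {x : R} (hdim : ringKrullDim R = 1)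
    (hx : IsSMulRegular M x) (h : I • (⊤ : Submodule R M) = Ideal.span {x} • ⊤) :
    HasMultiplicity I M ((lengthSMulQuotient I M).toNat : ℝ) := by
  refine ⟨1, hdim, ?_⟩
  refine tendsto_const_nhds.congr' ?_
  -- The sequence is constant for `n > 0`; at `n = 0` the quotient takes the default value `0`.
  filter_upwards [eventually_gt_atTop 0] with n hn
  rw [lengthSMulQuotient_eq_of_smul_top_eq hx h, Ideal.pow_smul_top_eq_of_smul_top_eq h,
    Module.length_quotient_pow_span_singleton hx, ENat.toNat_mul, ENat.toNat_natCast]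
  have : (n : ℝ) ≠ 0 := by positivity
  push_cast
  field_simp
  simp

theorem Module.length_quotient_span_singleton_ne_top [Module.Finite R M] [IsNoetherianRing R]
    [Ring.KrullDimLE 1 R] {x : R} (hx : x ∈ nonZeroDivisors R) :
    Module.length R (M ⧸ (Ideal.span {x} • ⊤ : Submodule R M)) ≠ ⊤ := by
  have hart : IsArtinianRing (R ⧸ Ideal.span {x}) := by
    have := (isFiniteLength_iff_isNoetherian_isArtinian.mp
      (isFiniteLength_quotient_span_singleton R hx)).2
    exact isArtinian_of_tower R this
  have : Module.Finite (R ⧸ Ideal.span {x}) (M ⧸ (Ideal.span {x} • ⊤ : Submodule R M)) :=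
    Module.Finite.of_restrictScalars_finite R _ _
  rw [Module.length_eq_of_surjective (S := R) (R := R ⧸ Ideal.span {x})
    (M := M ⧸ (Ideal.span {x} • ⊤ : Submodule R M)) Ideal.Quotient.mk_surjective]
  exact Module.length_ne_top

end Multiplicity

/-! ### The fractional ideal `K` and finiteness of `R[K]` -/

section FractionalIdeal

variable {R : Type*} [CommRing R] {Q : Type*} [CommRing Q] [Algebra R Q]

theorem mem_invMulIdeal_iff [IsFractionRing R Q] {x : R} (hx : x ∈ nonZeroDivisors R)
    {I : Ideal R} {q : Q} :
    q ∈ invMulIdeal Q x I ↔ ∃ w ∈ I, algebraMap R Q x * q = algebraMap R Q w := by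
  have hu : IsUnit (algebraMap R Q x) := IsLocalization.map_units Q (⟨x, hx⟩ : nonZeroDivisors R)
  simp only [invMulIdeal, Submodule.mem_map, exists_exists_and_eq_and, Algebra.linearMap_apply,
    LinearMap.mulLeft_apply]
  refine exists_congr fun w ↦ and_congr_right fun _ ↦ ⟨?_, fun h ↦ ?_⟩
  · rintro rfl
    rw [← mul_assoc, Ring.mul_inverse_cancel _ hu, one_mul]
  · rw [← h, ← mul_assoc, Ring.inverse_mul_cancel _ hu, one_mul]

theorem one_mem_invMulIdeal [IsFractionRing R Q] {x : R} (hx : x ∈ nonZeroDivisors R)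
    {I : Ideal R} (hxI : x ∈ I) : (1 : Q) ∈ invMulIdeal Q x I :=
  (mem_invMulIdeal_iff hx).mpr ⟨x, hxI, mul_one _⟩

theorem invMulIdeal_pow (x : R) (I : Ideal R) (n : ℕ) :
    invMulIdeal Q x I ^ n = (Submodule.map (Algebra.linearMap R Q) (I ^ n)).map
      (LinearMap.mulLeft R (Ring.inverse (algebraMap R Q x) ^ n)) := by
  have h : ∀ (c : Q) (N : Submodule R Q), N.map (LinearMap.mulLeft R c) = (R ∙ c) * N :=
    fun c N ↦ by
      ext q
      simp [Submodule.mem_span_singleton_mul]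
  rw [invMulIdeal, h, h, mul_pow, Submodule.span_pow, Set.singleton_pow]
  congr 1
  exact (map_pow (Submodule.mapHom (Algebra.ofId R Q)) I n).symm

/-- Divide the reduction equation by `x ^ (n + 1)`. -/
theorem invMulIdeal_pow_succ_eq [IsFractionRing R Q] {x : R} (hx : x ∈ nonZeroDivisors R)
    {I : Ideal R} {n : ℕ} (hn : Ideal.span {x} * I ^ n = I ^ (n + 1)) :
    invMulIdeal Q x I ^ (n + 1) = invMulIdeal Q x I ^ n := by
  have hu : IsUnit (algebraMap R Q x) := IsLocalization.map_units Q (⟨x, hx⟩ : nonZeroDivisors R)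
  have hmap : Submodule.map (Algebra.linearMap R Q) (I ^ (n + 1)) =
      (Submodule.map (Algebra.linearMap R Q) (I ^ n)).map
        (LinearMap.mulLeft R (algebraMap R Q x)) := by
    rw [← hn]
    ext q
    simp only [Submodule.mem_map, exists_exists_and_eq_and, Ideal.mem_span_singleton_mul]
    exact exists_congr fun a ↦ and_congr_right fun _ ↦ by simp
  rw [invMulIdeal_pow, invMulIdeal_pow, hmap, ← Submodule.map_comp, ← LinearMap.mulLeft_mul,
    pow_succ, mul_assoc, Ring.inverse_mul_cancel _ hu, mul_one]

/-- Since `K ^ n * K ^ n = K ^ (2 * n) = K ^ n`, this power is itself a subalgebra, and it contains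
`K`. -/
theorem adjoin_le_pow_of_pow_succ_eq {K : Submodule R Q} (h1 : 1 ∈ K) {n : ℕ}
    (hn : K ^ (n + 1) = K ^ n) :
    Subalgebra.toSubmodule (Algebra.adjoin R (K : Set Q)) ≤ K ^ n := by
  have hadd : ∀ m, K ^ (n + m) = K ^ n := fun m ↦ by
    induction m with
    | zero => rfl
    | succ m ih => rw [← add_assoc, pow_succ, ih, ← pow_succ, hn]
  have h1n : (1 : Q) ∈ K ^ n := by simpa using Submodule.pow_mem_pow K h1 n
  let S : Subalgebra R Q := Submodule.toSubalgebra (K ^ n) h1n fun a b ha hb ↦ by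
    rw [← hadd n, pow_add]
    exact Submodule.mul_mem_mul ha hb
  have hKS : K ≤ K ^ n := by
    intro k hk
    rw [← hn, pow_succ]
    simpa using Submodule.mul_mem_mul h1n hk
  exact fun q hq ↦ (Algebra.adjoin_le hKS : _ ≤ S) hq

end FractionalIdeal

theorem mainTheorem11 {R : Type u} [CommRing R] [IsLocalRing R]
    (hCM : IsCohenMacaulayLocalRing R) (hdim : ringKrullDim R = 1)
    (hgen : IsGenericallyGorenstein R) (hnG : ¬ IsGorensteinLocalRing R)
    {Q : Type v} [CommRing Q] [Algebra R Q] [IsFractionRing R Q]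
    (ω : Ideal R) (hω : IsCanonicalIdeal ω)
    (x : R) (hx : IsMinimalReduction (Ideal.span {x}) ω)
    (K : Submodule R Q) (hK : K = invMulIdeal Q x ω) :
    HasMinimalMultiplicity ω ↥(Algebra.adjoin R (K : Set Q)) := by
  have hnoeth : IsNoetherianRing R := hCM.1
  have : Ring.KrullDimLE 1 R := Ring.krullDimLE_iff.mpr hdim.le
  obtain ⟨y, hy, hym⟩ := hCM.2.exists_mem_nonZeroDivisors hdim
  obtain ⟨w, hw, hw0⟩ := hω.exists_mem_nonZeroDivisors hdim hy hym
  have hx0 : x ∈ nonZeroDivisors R := hx.1.mem_nonZeroDivisors hw hw0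
  have hxω : x ∈ ω := hx.1.1 (Ideal.mem_span_singleton_self x)
  have : Nontrivial Q := (IsLocalization.injective Q (le_refl (nonZeroDivisors R))).nontrivial
  have hreg : ∀ r ∈ nonZeroDivisors R, IsSMulRegular (Algebra.adjoin R (K : Set Q)) r := by
    intro r hr a b hab
    have hu : IsUnit (algebraMap R Q r) := IsLocalization.map_units Q (⟨r, hr⟩ : nonZeroDivisors R)
    refine Subtype.ext (hu.mul_left_cancel ?_)
    simpa [Algebra.smul_def] using congrArg Subtype.val hab
  have hfin : Module.Finite R (Algebra.adjoin R (K : Set Q)) := by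
    obtain ⟨n, hn⟩ := hx.1.2
    have hle := adjoin_le_pow_of_pow_succ_eq (hK ▸ one_mem_invMulIdeal hx0 hxω : (1 : Q) ∈ K)
      (hK ▸ invMulIdeal_pow_succ_eq hx0 hn : K ^ (n + 1) = K ^ n)
    have hfg : (K ^ n).FG := by
      refine Submodule.FG.pow ?_ n
      rw [hK]
      exact ((IsNoetherian.noetherian ω).map _).map _
    have : Module.Finite R ↥(K ^ n) := Module.Finite.iff_fg.mpr hfg
    exact Module.Finite.of_injective (Submodule.inclusion hle) (Submodule.inclusion_injective hle)
  have hsmul : ω • (⊤ : Submodule R (Algebra.adjoin R (K : Set Q))) = Ideal.span {x} • ⊤ := by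
    refine le_antisymm (Submodule.smul_le.mpr fun r hr s _ ↦ ?_) (Submodule.smul_mono_left hx.1.1)
    -- Write `r = x q` in `Q`; then `q ∈ K`, so `q s` stays in `R[K]` and `r s = x (q s)`.
    obtain ⟨q, hq⟩ := (IsLocalization.map_units Q (⟨x, hx0⟩ : nonZeroDivisors R)).dvd
      (a := algebraMap R Q r)
    have hqK : q ∈ K := hK ▸ (mem_invMulIdeal_iff hx0).mpr ⟨r, hr, hq.symm⟩
    have hrs : r • s = x • (⟨q, Algebra.subset_adjoin hqK⟩ * s) := by
      ext
      simp [Algebra.smul_def, hq, mul_assoc]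
    rw [hrs]
    exact Submodule.smul_mem_smul (Ideal.mem_span_singleton_self x) Submodule.mem_top
  exact
    { radical_eq := Ideal.radical_eq_maximalIdeal_of_mem_nonZeroDivisors (hω.ne_top hnG) hxω hx0
      finite := hfin
      nontrivial := inferInstance
      torsionFree := ⟨fun r hr ↦ hreg r hr.mem_nonZeroDivisors⟩
      length_ne_top := by
        rw [lengthSMulQuotient_eq_of_smul_top_eq (hreg x hx0) hsmul]
        exact Module.length_quotient_span_singleton_ne_top hx0
      multiplicity_eq := hasMultiplicity_of_smul_top_eq hdim (hreg x hx0) hsmul }
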